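/- Let $P=(X,\leqslant)$ be a finite poset of width $2$ (that is, a largest antichain of $P$ has exactly $2$ elements). Let $\bar G(P)$ be its incomparability graph, i.e. the graph on $X$ in which two elements are adjacent if and only if they are incomparable in $P$, and let $e(P)$ be the number of linear extensions of $P$. For a finite graph $G=(V,E)$ with $n=|V|$, let $\mathrm{STAB}(G)\subseteq\mathbb{R}^V$ be the convex hull of the characteristic vectors of the stable sets of $G$, and let $$H(G)=\min_{x\in \mathrm{STAB}(G),\ x>0}\ -\sum_{v\in V}\frac1n\log_2 x_v$$ be the entropy of $G$. Then $$|P|\cdot H(\bar G(P)) = 2\log_2 e(P)$$ if and only if the maximum degree of $\bar G(P)$ is $1$. Moreover, the maximum degree of $\bar G(P)$ is $1$ if and only if $P$ is an ordinal sum $A_1\oplus A_2\oplus\cdots\oplus A_k$ of antichains with $|A_i|\in\{1,2\}$ for every $i$ (that is, $X$ is partitioned into antichains $A_1,\dots,A_k$ of one or two elements such that every element of $A_i$ is smaller than every element of $A_j$ whenever $i<j$). -/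

import Mathlib

/-- The incomparability graph of a poset: two elements are adjacent iff neither is `≤` the other. -/
def incompGraph (P : Type*) [PartialOrder P] : SimpleGraph P where
  Adj a b := IncompRel (· ≤ ·) a b
  symm := ⟨fun _ _ h => ⟨h.2, h.1⟩⟩
  loopless := ⟨fun _ h => h.1 le_rfl⟩

open Classical in
/-- The width of a finite poset: the size of a largest antichain. -/
noncomputable def posetWidth (P : Type*) [PartialOrder P] [Fintype P] : ℕ :=
  (Finset.univ.filter fun s : Finset P => IsAntichain (· ≤ ·) (s : Set P)).sup Finset.card

/-- The number `e(P)` of linear extensions of a finite poset, a linear extension being an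
order-preserving bijection onto `{0, …, |P| - 1}`. -/
noncomputable def numLinearExtensions (P : Type*) [PartialOrder P] [Fintype P] : ℕ :=
  Nat.card {f : P ≃ Fin (Fintype.card P) // Monotone f}

/-- The stable set polytope `STAB(G)`: the convex hull of the characteristic vectors of the
stable sets of `G`. -/
def stabPolytope {V : Type*} (G : SimpleGraph V) : Set (V → ℝ) :=
  convexHull ℝ {x | ∃ S : Set V, G.IsIndepSet S ∧ x = S.indicator 1}

/-- The values of `-∑ v, (1 / n) log₂ (x v)` at the points `x > 0` of `STAB(G)`. -/
def entropyValues {V : Type*} [Fintype V] (G : SimpleGraph V) : Set ℝ :=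
  (fun x : V → ℝ => -∑ v, (1 / (Fintype.card V : ℝ)) * Real.logb 2 (x v)) ''
    {x | x ∈ stabPolytope G ∧ ∀ v, 0 < x v}

/-- The (Körner) entropy of a finite graph, for the uniform distribution on the vertices.
The infimum is a minimum, see `graphEntropy_isLeast`. -/
noncomputable def graphEntropy {V : Type*} [Fintype V] (G : SimpleGraph V) : ℝ :=
  sInf (entropyValues G)

/-- The infimum that defines the graph entropy is attained. -/
theorem graphEntropy_isLeast {V : Type*} [Fintype V] (G : SimpleGraph V) :
    IsLeast (entropyValues G) (graphEntropy G) := by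
  suffices h : ∃ a, IsLeast (entropyValues G) a by
    obtain ⟨a, ha⟩ := h
    rw [graphEntropy, ha.csInf_eq]
    exact ha
  have hfin : {x : V → ℝ | ∃ S : Set V, G.IsIndepSet S ∧ x = S.indicator 1}.Finite :=
    (Set.finite_range fun S : Set V => (S.indicator 1 : V → ℝ)).subset
      (by rintro x ⟨S, -, rfl⟩; exact ⟨S, rfl⟩)
  have hcomp : IsCompact (stabPolytope G) := hfin.isCompact_convexHull (𝕜 := ℝ)
  have hnonneg : ∀ x ∈ stabPolytope G, ∀ v, 0 ≤ x v := by
    have hsub : stabPolytope G ⊆ Set.Ici (0 : V → ℝ) := by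
      refine convexHull_min ?_ (convex_Ici 0)
      rintro x ⟨S, -, rfl⟩ v
      exact Set.indicator_nonneg (fun _ _ => zero_le_one) v
    exact fun x hx v => hsub hx v
  have hpos : ∃ x ∈ stabPolytope G, ∀ v, 0 < x v := by
    rcases isEmpty_or_nonempty V with hV | hV
    · exact ⟨(∅ : Set V).indicator 1, subset_convexHull ℝ _ ⟨∅, by simp, rfl⟩,
        fun v => hV.elim v⟩
    · have hn : (0 : ℝ) < Fintype.card V := by exact_mod_cast Fintype.card_pos
      refine ⟨∑ v : V, (1 / (Fintype.card V : ℝ)) • (({v} : Set V).indicator 1 : V → ℝ), ?_, ?_⟩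
      · refine (convex_convexHull ℝ _).sum_mem (fun _ _ => by positivity) ?_ fun v _ =>
          subset_convexHull ℝ _ ⟨{v}, by simp, rfl⟩
        simp [hn.ne']
      · intro w
        rw [Finset.sum_apply]
        refine lt_of_lt_of_le (b := (1 / (Fintype.card V : ℝ))) (by positivity) ?_
        refine le_trans (le_of_eq ?_) (Finset.single_le_sum (fun v _ => ?_) (Finset.mem_univ w))
        · simp
        · exact mul_nonneg (by positivity) (Set.indicator_nonneg (fun _ _ => zero_le_one) w)
  obtain ⟨z, hz, hz0⟩ := hpos
  obtain ⟨x, hx, hmax⟩ := hcomp.exists_isMaxOn ⟨z, hz⟩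
    (f := fun x : V → ℝ => ∏ v, x v) (by fun_prop)
  have hprod : 0 < ∏ v, x v :=
    lt_of_lt_of_le (Finset.prod_pos fun v _ => hz0 v) (hmax hz)
  have hx0 : ∀ v, 0 < x v := fun v =>
    lt_of_le_of_ne (hnonneg x hx v) fun h =>
      hprod.ne' (Finset.prod_eq_zero (Finset.mem_univ v) h.symm)
  refine ⟨_, ⟨x, ⟨hx, hx0⟩, rfl⟩, ?_⟩
  rintro _ ⟨y, ⟨hy, hy0⟩, rfl⟩
  simp only [← Finset.mul_sum]
  rw [← Real.logb_prod _ _ (fun v _ => (hx0 v).ne'), ← Real.logb_prod _ _ (fun v _ => (hy0 v).ne')]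
  have h1 : ∏ v, y v ≤ ∏ v, x v := hmax hy
  have h2 := Real.logb_le_logb_of_le (b := 2) (by norm_num)
    (Finset.prod_pos fun v _ => hy0 v) h1
  exact neg_le_neg (mul_le_mul_of_nonneg_left h2 (by positivity))

/-- `P` is an ordinal sum `A₁ ⊕ ⋯ ⊕ A_k` of antichains with one or two elements: the `Aᵢ` partition
`P`, and every element of `Aᵢ` is below every element of `Aⱼ` when `i < j`. -/
def IsOrdinalSumOfSmallAntichains (P : Type*) [PartialOrder P] : Prop :=
  ∃ (k : ℕ) (A : Fin k → Finset P),
    (∀ i, IsAntichain (· ≤ ·) (A i : Set P)) ∧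
    (∀ i, (A i).card = 1 ∨ (A i).card = 2) ∧
    (∀ x : P, ∃! i, x ∈ A i) ∧
    (∀ i j, i < j → ∀ x ∈ A i, ∀ y ∈ A j, x < y)

/-!
Let `G` be the incomparability graph of `P`. A linear extension is determined by the order in which
it puts the two ends of each edge of `G`, so `e(P) ≤ 2 ^ |E(G)|`. On the other hand a point `x` of
`STAB(G)` has `x u + x v ≤ 1`, hence `-log₂ (x u) - log₂ (x v) ≥ 2`, on every edge `uv`, so that
`2 |E(G)| ≤ Δ(G) |P| H(G)`. Together these give `2 log₂ e(P) ≤ |P| H(G)` when `Δ(G) ≤ 1`.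

For the opposite inequality, induction produces a point `x > 0` of `STAB(G)` with
`e(P) ^ 2 * ∏ v, x v ≥ 1`, and with strict inequality unless `Δ(G) ≤ 1`. If `P` has two minimal
elements `a` and `b`, then every chain avoiding `a` stays a chain after the insertion of `a` or of
`b`; hence the points found for `P ∖ {a}` and `P ∖ {b}` can be increased until their coordinates at
`a` and `b` add up to `1`. A suitable convex combination of them then matches the recursion
`e(P) = e(P ∖ {a}) + e(P ∖ {b})`, and equality forces the first point to be `1` at `b` and the
second to be `1` at `a`, which leaves `a` and `b` no other neighbours.

If `Δ(G) ≤ 1`, incomparable elements have the same strict lower bounds. The number of strict lower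
bounds is therefore a rank function, and its level sets are the summands of the ordinal sum.
-/

section Graph

variable {V : Type*} {G : SimpleGraph V}

theorem maxDegree_le_one_iff [Fintype V] [DecidableRel G.Adj] :
    G.maxDegree ≤ 1 ↔ ∀ u v w, G.Adj u v → G.Adj u w → v = w := by
  have hdeg (u : V) : G.degree u ≤ 1 ↔ ∀ v w, G.Adj u v → G.Adj u w → v = w := by
    simp only [← G.card_neighborFinset_eq_degree, Finset.card_le_one, G.mem_neighborFinset]
    exact ⟨fun h v w hv hw => h v hv w hw, fun h v hv w hw => h v w hv hw⟩
  simp only [← hdeg]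
  exact ⟨fun h u => (G.degree_le_maxDegree u).trans h, G.maxDegree_le_of_forall_degree_le 1⟩

/-- The edges of `G` with both ends in `S` form a matching. -/
def IsMatchingOn (G : SimpleGraph V) (S : Set V) : Prop :=
  ∀ u ∈ S, ∀ v ∈ S, ∀ w ∈ S, G.Adj u v → G.Adj u w → v = w

theorem isMatchingOn_univ_iff_maxDegree_le_one [Fintype V] [DecidableRel G.Adj] :
    IsMatchingOn G Set.univ ↔ G.maxDegree ≤ 1 := by
  simp [IsMatchingOn, maxDegree_le_one_iff]

theorem IsMatchingOn.of_diff_singleton {S : Set V} {a b : V} (h : IsMatchingOn G (S \ {a}))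
    (ha : ∀ c ∈ S, G.Adj c a → c = b) (hb : ∀ c ∈ S, G.Adj c b → c = a) : IsMatchingOn G S := by
  intro u hu v hv w hw huv huw
  by_cases hua : u = a
  · subst hua
    exact (ha v hv huv.symm).trans (ha w hw huw.symm).symm
  by_cases hva : v = a
  · subst hva
    obtain rfl := ha u hu huv
    exact (hb w hw huw.symm).symm
  by_cases hwa : w = a
  · subst hwa
    obtain rfl := ha u hu huw
    exact hb v hv huv.symm
  exact h u ⟨hu, hua⟩ v ⟨hv, hva⟩ w ⟨hw, hwa⟩ huv huw

theorem sum_sum_neighborFinset [Fintype V] [DecidableRel G.Adj] {R : Type*} [Semiring R]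
    (f : V → R) : ∑ v, ∑ u ∈ G.neighborFinset v, f u = ∑ v, G.degree v * f v := by
  rw [Finset.sum_comm' (t' := Finset.univ) (s' := fun u => G.neighborFinset u)
    (by simp [G.adj_comm])]
  simp

end Graph

section StableSetPolytope

variable {V : Type*} {G : SimpleGraph V} {x : V → ℝ}

theorem sum_le_one_of_mem_stabPolytope (hx : x ∈ stabPolytope G) {K : Finset V}
    (hK : G.IsClique K) : ∑ v ∈ K, x v ≤ 1 := by
  classical
  have hlin : IsLinearMap ℝ fun y : V → ℝ => ∑ v ∈ K, y v :=
    ⟨fun y z => by simp [Finset.sum_add_distrib], fun c y => by simp [Finset.mul_sum]⟩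
  refine convexHull_min ?_ (convex_halfSpace_le hlin 1) hx
  rintro _ ⟨C, hC, rfl⟩
  have hcard : (K.filter (· ∈ C)).card ≤ 1 := by
    refine Finset.card_le_one.2 fun u hu v hv => by_contra fun huv => ?_
    rw [Finset.mem_filter] at hu hv
    exact hC hu.2 hv.2 huv (hK hu.1 hv.1 huv)
  simpa [Set.indicator_apply] using hcard

theorem le_one_of_mem_stabPolytope (hx : x ∈ stabPolytope G) (v : V) : x v ≤ 1 := by
  simpa using sum_le_one_of_mem_stabPolytope hx (K := {v}) (by simp)

theorem add_le_one_of_mem_stabPolytope (hx : x ∈ stabPolytope G) {u v : V} (h : G.Adj u v) :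
    x u + x v ≤ 1 := by
  classical
  have hK : G.IsClique ({u, v} : Finset V) := by
    simpa using SimpleGraph.isClique_pair.2 fun _ => h
  simpa [Finset.sum_pair h.ne] using sum_le_one_of_mem_stabPolytope hx hK

end StableSetPolytope

section Entropy

variable {V : Type*} [Fintype V]

theorem isLeast_card_mul_graphEntropy (G : SimpleGraph V) :
    IsLeast ((fun x : V → ℝ => -∑ v, Real.logb 2 (x v)) ''
      {x | x ∈ stabPolytope G ∧ ∀ v, 0 < x v}) (Fintype.card V * graphEntropy G) := by
  have hscale (x : V → ℝ) : (Fintype.card V : ℝ) *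
      -∑ v, (1 / (Fintype.card V : ℝ)) * Real.logb 2 (x v) = -∑ v, Real.logb 2 (x v) := by
    cases isEmpty_or_nonempty V
    · simp
    · rw [← Finset.mul_sum]
      field_simp
  have hmono : Monotone ((Fintype.card V : ℝ) * ·) :=
    monotone_mul_left_of_nonneg (Nat.cast_nonneg _)
  simpa only [entropyValues, Set.image_image, hscale] using
    hmono.map_isLeast (graphEntropy_isLeast G)

theorem card_mul_graphEntropy_nonneg (G : SimpleGraph V) : 0 ≤ Fintype.card V * graphEntropy G := by
  obtain ⟨x, ⟨hx, hpos⟩, hmin⟩ := (isLeast_card_mul_graphEntropy G).1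
  rw [← hmin, neg_nonneg]
  exact Finset.sum_nonpos fun v _ =>
    Real.logb_nonpos one_lt_two (hpos v).le (le_one_of_mem_stabPolytope hx v)

theorem logb_add_logb_le_neg_two {x y : ℝ} (hx : 0 < x) (hy : 0 < y) (h : x + y ≤ 1) :
    Real.logb 2 x + Real.logb 2 y ≤ -2 := by
  rw [← Real.logb_mul hx.ne' hy.ne', Real.logb_le_iff_le_rpow one_lt_two (mul_pos hx hy)]
  have hamgm : x * y ≤ 1 / 4 := by nlinarith [sq_nonneg (x - y)]
  exact hamgm.trans_eq (by norm_num [Real.rpow_neg])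

theorem two_mul_card_edgeFinset_le_maxDegree_mul_graphEntropy (G : SimpleGraph V)
    [DecidableRel G.Adj] :
    2 * (G.edgeFinset.card : ℝ) ≤ G.maxDegree * (Fintype.card V * graphEntropy G) := by
  obtain ⟨x, ⟨hx, hpos⟩, hmin⟩ := (isLeast_card_mul_graphEntropy G).1
  simp only [← hmin, ← Finset.sum_neg_distrib]
  set cost : V → ℝ := fun v => -Real.logb 2 (x v)
  have hcost (v : V) : 0 ≤ cost v :=
    neg_nonneg.2 (Real.logb_nonpos one_lt_two (hpos v).le (le_one_of_mem_stabPolytope hx v))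
  have hedge {v u : V} (h : G.Adj v u) : 2 ≤ cost v + cost u := by
    linarith [logb_add_logb_le_neg_two (hpos v) (hpos u) (add_le_one_of_mem_stabPolytope hx h)]
  have hdouble : 2 * (2 * (G.edgeFinset.card : ℝ)) ≤ 2 * ∑ v, G.degree v * cost v :=
    calc 2 * (2 * (G.edgeFinset.card : ℝ)) = ∑ v, ∑ _u ∈ G.neighborFinset v, 2 := by
          simp only [Finset.sum_const, G.card_neighborFinset_eq_degree, nsmul_eq_mul,
            ← Finset.sum_mul, ← Nat.cast_sum, G.sum_degrees_eq_twice_card_edges]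
          push_cast
          ring
      _ ≤ ∑ v, ∑ u ∈ G.neighborFinset v, (cost v + cost u) := by
          gcongr with v _ u hu
          exact hedge ((G.mem_neighborFinset v u).1 hu)
      _ = 2 * ∑ v, G.degree v * cost v := by
          simp only [Finset.sum_add_distrib, sum_sum_neighborFinset, Finset.sum_const,
            G.card_neighborFinset_eq_degree, nsmul_eq_mul, two_mul]
  calc 2 * (G.edgeFinset.card : ℝ) ≤ ∑ v, G.degree v * cost v := by linarith
    _ ≤ ∑ v, G.maxDegree * cost v := by
        gcongr with v
        · exact hcost v
        · exact G.degree_le_maxDegree v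
    _ = G.maxDegree * ∑ v, cost v := by rw [Finset.mul_sum]

end Entropy

section IncomparabilityGraph

variable {P : Type*} [PartialOrder P]

theorem isClique_incompGraph_iff_isAntichain {s : Set P} :
    (incompGraph P).IsClique s ↔ IsAntichain (· ≤ ·) s :=
  ⟨fun h _ hx _ hy hxy => (h hx hy hxy).1, fun h _ hx _ hy hxy => ⟨h hx hy hxy, h hy hx hxy.symm⟩⟩

theorem isIndepSet_incompGraph_iff_isChain {s : Set P} :
    (incompGraph P).IsIndepSet s ↔ IsChain (· ≤ ·) s := by
  refine forall₂_congr fun x _ => forall₂_congr fun y _ => imp_congr_right fun _ => ?_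
  change ¬ IncompRel (· ≤ ·) x y ↔ x ≤ y ∨ y ≤ x
  exact not_incompRel_iff_symmGen

theorem cliqueFree_incompGraph_iff_posetWidth_lt [Fintype P] {n : ℕ} :
    (incompGraph P).CliqueFree n ↔ posetWidth P < n := by
  classical
  rw [← not_iff_not, not_lt]
  constructor
  · intro h
    obtain ⟨s, hs, rfl⟩ : ∃ s, (incompGraph P).IsNClique n s := by
      simpa [SimpleGraph.CliqueFree] using h
    exact Finset.le_sup (f := Finset.card)
      (by simpa using isClique_incompGraph_iff_isAntichain.1 hs)
  · intro h hfree
    obtain ⟨s, hs, hcard⟩ := Finset.exists_mem_eq_sup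
      (Finset.univ.filter fun s : Finset P => IsAntichain (· ≤ ·) (s : Set P)) ⟨∅, by simp⟩
      Finset.card
    refine hfree.mono h s ⟨isClique_incompGraph_iff_isAntichain.2 (by simpa using hs), ?_⟩
    exact hcard.symm

theorem incompGraph_adj_of_minimal {S : Set P} {a b : P} (ha : Minimal (· ∈ S) a)
    (hb : Minimal (· ∈ S) b) (hab : a ≠ b) : (incompGraph P).Adj a b :=
  isClique_incompGraph_iff_isAntichain.2 (setOfPred_minimal_antichain (· ∈ S)) ha hb hab

theorem exists_isLeast_or_exists_minimal_pair {S : Finset P} (hS : S.Nonempty) :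
    (∃ a, IsLeast (S : Set P) a) ∨
      ∃ a b, a ≠ b ∧ Minimal (· ∈ S) a ∧ Minimal (· ∈ S) b := by
  obtain ⟨a, ha⟩ := S.exists_minimal hS
  by_cases hleast : ∃ a, IsLeast (S : Set P) a
  · exact Or.inl hleast
  obtain ⟨c, hc, hac⟩ : ∃ c ∈ S, ¬ a ≤ c := by
    by_contra! h
    exact hleast ⟨a, ha.1, h⟩
  obtain ⟨b, hbc, hb⟩ := S.exists_le_minimal hc
  exact Or.inr ⟨a, b, fun hab => hac (hab ▸ hbc), ha, hb⟩

theorem le_of_minimal_of_incompGraph_adj (hG : (incompGraph P).CliqueFree 3) {S : Set P}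
    {a b c : P} (ha : Minimal (· ∈ S) a) (hb : Minimal (· ∈ S) b) (hab : a ≠ b) (hc : c ∈ S)
    (hbc : (incompGraph P).Adj b c) : a ≤ c := by
  classical
  by_contra hac
  have hac' : (incompGraph P).Adj a c := ⟨hac, fun hca => hac (ha.2 hc hca)⟩
  exact hG {a, b, c} (SimpleGraph.is3Clique_triple_iff.2
    ⟨incompGraph_adj_of_minimal ha hb hab, hac', hbc⟩)

theorem isChain_insert_or_isChain_insert (hG : (incompGraph P).CliqueFree 3) {S C : Set P}
    {a b : P} (ha : Minimal (· ∈ S) a) (hb : Minimal (· ∈ S) b) (hab : a ≠ b) (hCS : C ⊆ S)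
    (hC : IsChain (· ≤ ·) C) :
    IsChain (· ≤ ·) (insert a C) ∨ IsChain (· ≤ ·) (insert b C) := by
  by_cases hbC : ∀ c ∈ C, b ≠ c → b ≤ c ∨ c ≤ b
  · exact Or.inr (hC.insert hbC)
  push Not at hbC
  obtain ⟨c, hc, -, hbc⟩ := hbC
  have hac : a ≤ c := le_of_minimal_of_incompGraph_adj hG ha hb hab (hCS hc) hbc
  refine Or.inl (hC.insert fun d hd _ => by_contra fun had => ?_)
  rw [not_or] at had
  have hbd : b ≤ d := le_of_minimal_of_incompGraph_adj hG hb ha hab.symm (hCS hd) had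
  rcases hC.total hc hd with hcd | hdc
  · exact had.1 (hac.trans hcd)
  · exact hbc.1 (hbd.trans hdc)

end IncomparabilityGraph

section ChainHull

variable {P : Type*} [PartialOrder P] {S : Set P} {a b : P} {x : P → ℝ}

/-- The convex hull of the characteristic vectors of the chains contained in `S`: the stable set
polytope of the incomparability graph of `S`, with its points extended by zero to all of `P`. -/
def chainHull (S : Set P) : Set (P → ℝ) :=
  convexHull ℝ {x | ∃ C ⊆ S, IsChain (· ≤ ·) C ∧ x = C.indicator 1}

theorem indicator_mem_chainHull {C : Set P} (hCS : C ⊆ S) (hC : IsChain (· ≤ ·) C) :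
    C.indicator 1 ∈ chainHull S :=
  subset_convexHull ℝ _ ⟨C, hCS, hC, rfl⟩

theorem chainHull_subset_stabPolytope (S : Set P) :
    chainHull S ⊆ stabPolytope (incompGraph P) := by
  refine convexHull_mono ?_
  rintro _ ⟨C, -, hC, rfl⟩
  exact ⟨C, isIndepSet_incompGraph_iff_isChain.2 hC, rfl⟩

theorem update_one_mem_chainHull (ha : a ∈ S) (hcomp : ∀ c ∈ S, a ≤ c ∨ c ≤ a)
    [DecidableEq P] (hx : x ∈ chainHull (S \ {a})) : Function.update x a 1 ∈ chainHull S := by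
  refine convexHull_min (t := {y : P → ℝ | Function.update y a 1 ∈ chainHull S}) ?_ ?_ hx
  · rintro _ ⟨C, hCS, hC, rfl⟩
    have hins : Function.update (C.indicator (1 : P → ℝ)) a 1 = (insert a C).indicator 1 := by
      ext v
      by_cases hv : v = a <;> by_cases hvC : v ∈ C <;> simp [hv, hvC]
    rw [Set.mem_ofPred_eq, hins]
    exact indicator_mem_chainHull (Set.insert_subset ha (hCS.trans Set.sdiff_subset))
      (hC.insert fun c hc _ => hcomp c (hCS hc).1)
  · intro y hy z hz α β hα hβ hαβ
    have hcomb : Function.update (α • y + β • z) a 1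
        = α • Function.update y a 1 + β • Function.update z a 1 := by
      ext v
      by_cases hv : v = a <;> simp [hv, hαβ]
    rw [Set.mem_ofPred_eq, hcomb]
    exact convex_convexHull ℝ _ hy hz hα hβ hαβ

theorem exists_mem_chainHull_add_eq_one (hG : (incompGraph P).CliqueFree 3)
    (ha : Minimal (· ∈ S) a) (hb : Minimal (· ∈ S) b) (hab : a ≠ b)
    (hx : x ∈ chainHull (S \ {a})) : ∃ z ∈ chainHull S, x ≤ z ∧ z a + z b = 1 := by
  refine convexHull_min (t := {y | ∃ z ∈ chainHull S, y ≤ z ∧ z a + z b = 1}) ?_ ?_ hx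
  · rintro _ ⟨C, hCS, hC, rfl⟩
    have haC : a ∉ C := fun h => (hCS h).2 rfl
    have hCS' : C ⊆ S := hCS.trans Set.sdiff_subset
    have hle (c : P) : C.indicator (1 : P → ℝ) ≤ (insert c C).indicator 1 :=
      Set.indicator_le_indicator_of_subset (Set.subset_insert c C) fun _ => zero_le_one
    by_cases hbC : IsChain (· ≤ ·) (insert b C)
    · exact ⟨_, indicator_mem_chainHull (Set.insert_subset hb.1 hCS') hbC, hle b,
        by simp [hab, haC]⟩
    · have haC' := (isChain_insert_or_isChain_insert hG ha hb hab hCS' hC).resolve_right hbC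
      have hb' : b ∉ C := fun h => hbC (by rwa [Set.insert_eq_of_mem h])
      exact ⟨_, indicator_mem_chainHull (Set.insert_subset ha.1 hCS') haC', hle a,
        by simp [hab.symm, hb']⟩
  · rintro y ⟨z, hz, hyz, hzab⟩ y' ⟨z', hz', hyz', hzab'⟩ α β hα hβ hαβ
    refine ⟨α • z + β • z', convex_convexHull ℝ _ hz hz' hα hβ hαβ, by gcongr, ?_⟩
    simp only [Pi.add_apply, Pi.smul_apply, smul_eq_mul]
    linear_combination α * hzab + β * hzab' + hαβ

end ChainHull

section LinearExtensions

variable {P : Type*} [PartialOrder P]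

/-- The linear extensions of the subposet `S`, each written as the list of the elements of `S` in
increasing order. -/
def linExtLists (S : Finset P) : Set (List P) :=
  {l | (l : Multiset P) = S.val ∧ l.Pairwise fun x y => ¬ y ≤ x}

theorem linExtLists_finite (S : Finset P) : (linExtLists S).Finite :=
  S.val.lists.finite_toSet.subset fun l hl => (Multiset.mem_lists_iff S.val l).2 hl.1.symm

theorem length_of_mem_linExtLists_univ [Fintype P] {l : List P}
    (hl : l ∈ linExtLists (Finset.univ : Finset P)) : l.length = Fintype.card P := by
  rw [← Multiset.coe_card, hl.1, Finset.card_val, Finset.card_univ]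

theorem linExtLists_empty : linExtLists (∅ : Finset P) = {[]} := by
  ext l
  simp +contextual [linExtLists]

variable {S : Finset P} {a b : P}

theorem cons_mem_linExtLists [DecidableEq P] (ha : Minimal (· ∈ S) a) {l : List P}
    (hl : l ∈ linExtLists (S.erase a)) : a :: l ∈ linExtLists S := by
  obtain ⟨hmem, hsorted⟩ := hl
  refine ⟨?_, List.pairwise_cons.2 ⟨fun c hc hca => ?_, hsorted⟩⟩
  · rw [← Multiset.cons_coe, hmem, Finset.erase_val, Multiset.cons_erase ha.1]
  · have hcS : c ∈ S.erase a := by rwa [← Finset.mem_val, ← hmem, Multiset.mem_coe]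
    exact Finset.ne_of_mem_erase hcS (ha.eq_of_le (Finset.mem_of_mem_erase hcS) hca)

theorem linExtLists_nonempty (S : Finset P) : (linExtLists S).Nonempty := by
  classical
  induction S using Finset.strongInduction with
  | H S ih =>
    rcases S.eq_empty_or_nonempty with rfl | hS
    · simp [linExtLists_empty]
    · obtain ⟨a, ha⟩ := S.exists_minimal hS
      obtain ⟨l, hl⟩ := ih _ (Finset.erase_ssubset ha.1)
      exact ⟨a :: l, cons_mem_linExtLists ha hl⟩

theorem ncard_linExtLists_pos (S : Finset P) : 0 < (linExtLists S).ncard :=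
  (Set.ncard_pos (linExtLists_finite S)).2 (linExtLists_nonempty S)

variable [DecidableEq P]

theorem ncard_linExtLists_erase_le (ha : Minimal (· ∈ S) a) :
    (linExtLists (S.erase a)).ncard ≤ (linExtLists S).ncard :=
  Set.ncard_le_ncard_of_injOn (List.cons a) (fun _ hl => cons_mem_linExtLists ha hl)
    List.cons_injective.injOn (linExtLists_finite S)

theorem ncard_linExtLists_erase_add_le (ha : Minimal (· ∈ S) a) (hb : Minimal (· ∈ S) b)
    (hab : a ≠ b) :
    (linExtLists (S.erase a)).ncard + (linExtLists (S.erase b)).ncard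
      ≤ (linExtLists S).ncard := by
  have hdisj : Disjoint (List.cons a '' linExtLists (S.erase a))
      (List.cons b '' linExtLists (S.erase b)) := by
    rw [Set.disjoint_left]
    rintro _ ⟨l, -, rfl⟩ ⟨l', -, h⟩
    exact hab (List.cons.inj h).1.symm
  rw [← Set.ncard_image_of_injective _ (List.cons_injective (a := a)),
    ← Set.ncard_image_of_injective (linExtLists (S.erase b)) (List.cons_injective (a := b)),
    ← Set.ncard_union_eq hdisj ((linExtLists_finite _).image _) ((linExtLists_finite _).image _)]
  refine Set.ncard_le_ncard (Set.union_subset ?_ ?_) (linExtLists_finite S)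
  · exact Set.image_subset_iff.2 fun _ hl => cons_mem_linExtLists ha hl
  · exact Set.image_subset_iff.2 fun _ hl => cons_mem_linExtLists hb hl

/-- The bijection sending each element of `P` to its position in the linear extension `l`. -/
def positionEquiv [Fintype P] {l : List P} (hl : l ∈ linExtLists (Finset.univ : Finset P)) :
    P ≃ Fin (Fintype.card P) :=
  have hnodup : l.Nodup := by
    rw [← Multiset.coe_nodup, hl.1]
    exact Finset.univ.nodup
  have hmem (v : P) : v ∈ l := by
    rw [← Multiset.mem_coe, hl.1]
    exact Finset.mem_univ v
  (hnodup.getEquivOfForallMemList l hmem).symm.trans (finCongr (length_of_mem_linExtLists_univ hl))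

theorem ofFn_positionEquiv_symm [Fintype P] {l : List P}
    (hl : l ∈ linExtLists (Finset.univ : Finset P)) : List.ofFn (positionEquiv hl).symm = l :=
  List.ext_getElem (by simp [length_of_mem_linExtLists_univ hl]) fun i _ _ => by
    simp [positionEquiv]

theorem monotone_positionEquiv [Fintype P] {l : List P}
    (hl : l ∈ linExtLists (Finset.univ : Finset P)) : Monotone (positionEquiv hl) := by
  intro x y hxy
  by_contra! hlt
  have hsorted := hl.2
  rw [← ofFn_positionEquiv_symm hl, List.pairwise_ofFn] at hsorted
  simpa [hxy] using hsorted hlt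

end LinearExtensions

theorem ncard_linExtLists_univ_le (P : Type*) [PartialOrder P] [Fintype P] :
    (linExtLists (Finset.univ : Finset P)).ncard ≤ numLinearExtensions P := by
  classical
  rw [numLinearExtensions, ← Nat.card_coe_set_eq]
  refine Nat.card_le_card_of_injective
    (fun l => ⟨positionEquiv l.2, monotone_positionEquiv l.2⟩) ?_
  rintro ⟨l, hl⟩ ⟨l', hl'⟩ h
  have hpos : positionEquiv hl = positionEquiv hl' := congrArg Subtype.val h
  rw [Subtype.mk.injEq, ← ofFn_positionEquiv_symm hl, ← ofFn_positionEquiv_symm hl', hpos]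

theorem numLinearExtensions_pos (P : Type*) [PartialOrder P] [Fintype P] :
    0 < numLinearExtensions P :=
  (ncard_linExtLists_pos Finset.univ).trans_le (ncard_linExtLists_univ_le P)

section BalancingWeights

variable {p q s t : ℝ}

theorem mul_sq_add_sq_le_of_sq_mul_le {σ τ : ℝ} (hp : 0 < p) (hq : 0 < q) (hσ : 0 ≤ σ)
    (hτ : 0 ≤ τ) (hpσ : (p + q) ^ 2 * σ ≤ p ^ 2) (hqτ : (p + q) ^ 2 * τ ≤ q ^ 2) :
    (p + q) * (σ * τ) * (p ^ 2 + q ^ 2) ≤ τ * p ^ 3 + σ * q ^ 3 ∧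
      (τ * p ^ 3 + σ * q ^ 3 = (p + q) * (σ * τ) * (p ^ 2 + q ^ 2) → σ = 0 ∧ τ = 0) := by
  have hgap : (p + q) * (σ * τ) * (p ^ 2 + q ^ 2) + 2 * (p + q) * p * q * (σ * τ)
      ≤ τ * p ^ 3 + σ * q ^ 3 := by
    linear_combination (p * τ) * hpσ + (q * σ) * hqτ
  have hstrict : 0 < 2 * (p + q) * p * q := by positivity
  refine ⟨le_trans (le_add_of_nonneg_right (by positivity)) hgap, fun heq => ?_⟩
  have hzero : σ * τ = 0 :=
    le_antisymm (nonpos_of_mul_nonpos_right (by linarith) hstrict) (mul_nonneg hσ hτ)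
  rw [hzero] at heq
  have hsum : τ * p ^ 3 + σ * q ^ 3 = 0 := by linarith
  rw [add_eq_zero_iff_of_nonneg (by positivity) (by positivity)] at hsum
  simpa [hp.ne', hq.ne', and_comm] using hsum

/-- The weights are those for which the averaged coordinates are `p / (p + q)` and `q / (p + q)`,
as they are in the extremal case `s = t = 1`. -/
theorem exists_weights_of_sq_mul_le (hp : 0 < p) (hq : 0 < q) (hs : s ≤ 1) (ht : t ≤ 1)
    (hps : (p + q) ^ 2 * (1 - s) ≤ p ^ 2) (hqt : (p + q) ^ 2 * (1 - t) ≤ q ^ 2) :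
    ∃ α β : ℝ, 0 < α ∧ 0 < β ∧ α + β = 1 ∧ (p + q) * (α * (1 - s) + β * t) = p ∧
      α * (s * p ^ 2) + β * (t * q ^ 2) ≤ p * q ∧
      (α * (s * p ^ 2) + β * (t * q ^ 2) = p * q → s = 1 ∧ t = 1) := by
  have hden : 0 < (p + q) * (s + t - 1) := by nlinarith [mul_pos hp hq, add_pos hp hq]
  have hα : 0 < q - (p + q) * (1 - t) := by nlinarith [mul_pos hp hq, add_pos hp hq]
  have hβ : 0 < p - (p + q) * (1 - s) := by nlinarith [mul_pos hp hq, add_pos hp hq]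
  obtain ⟨hle, heq⟩ := mul_sq_add_sq_le_of_sq_mul_le hp hq (sub_nonneg.2 hs) (sub_nonneg.2 ht)
    hps hqt
  set D := (p + q) * (s + t - 1) with hD
  set α := (q - (p + q) * (1 - t)) / D
  set β := (p - (p + q) * (1 - s)) / D
  have hαD : D * α = q - (p + q) * (1 - t) := mul_div_cancel₀ _ hden.ne'
  have hβD : D * β = p - (p + q) * (1 - s) := mul_div_cancel₀ _ hden.ne'
  have hαβ : α + β = 1 := mul_left_cancel₀ hden.ne' (by linear_combination hαD + hβD - hD)
  have hgap : D * (p * q - (α * (s * p ^ 2) + β * (t * q ^ 2)))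
      = (1 - t) * p ^ 3 + (1 - s) * q ^ 3
        - (p + q) * ((1 - s) * (1 - t)) * (p ^ 2 + q ^ 2) := by
    linear_combination -(s * p ^ 2) * hαD - (t * q ^ 2) * hβD + p * q * hD
  refine ⟨α, β, div_pos hα hden, div_pos hβ hden, hαβ, mul_left_cancel₀ hden.ne' ?_,
    sub_nonneg.1 (nonneg_of_mul_nonneg_right (hgap ▸ sub_nonneg.2 hle) hden), fun h => ?_⟩
  · linear_combination (p + q) * ((1 - s) * hαD + t * hβD) - p * hD
  · rw [h, sub_self, mul_zero] at hgap
    obtain ⟨hs1, ht1⟩ := heq (by linarith)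
    exact ⟨by linarith, by linarith⟩

theorem exists_weights_mul_add_mul_le (hp : 0 < p) (hq : 0 < q) (hs : 0 < s) (hs' : s ≤ 1)
    (ht : 0 < t) (ht' : t ≤ 1) :
    ∃ α β : ℝ, 0 ≤ α ∧ 0 ≤ β ∧ α + β = 1 ∧
      α * (s * p ^ 2) + β * (t * q ^ 2)
        ≤ (p + q) ^ 2 * ((α * (1 - s) + β * t) * (α * s + β * (1 - t))) ∧
      (α * (s * p ^ 2) + β * (t * q ^ 2)
        = (p + q) ^ 2 * ((α * (1 - s) + β * t) * (α * s + β * (1 - t))) →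
        s = 1 ∧ t = 1 ∧ 0 < α) := by
  rcases lt_or_ge (q ^ 2) ((p + q) ^ 2 * (1 - t)) with hqt | hqt
  · have hlt : t * q ^ 2 < (p + q) ^ 2 * (t * (1 - t)) := by nlinarith
    exact ⟨0, 1, le_rfl, zero_le_one, zero_add 1, by simpa using hlt.le,
      fun h => absurd (by simpa using h) hlt.ne⟩
  rcases lt_or_ge (p ^ 2) ((p + q) ^ 2 * (1 - s)) with hps | hps
  · have hlt : s * p ^ 2 < (p + q) ^ 2 * ((1 - s) * s) := by nlinarith
    exact ⟨1, 0, zero_le_one, le_rfl, add_zero 1, by simpa using hlt.le,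
      fun h => absurd (by simpa using h) hlt.ne⟩
  obtain ⟨α, β, hα, hβ, hαβ, hfirst, hle, heq⟩ := exists_weights_of_sq_mul_le hp hq hs' ht' hps hqt
  have hsecond : (p + q) * (α * s + β * (1 - t)) = q := by
    linear_combination (p + q) * hαβ - hfirst
  have hprod : (p + q) ^ 2 * ((α * (1 - s) + β * t) * (α * s + β * (1 - t))) = p * q := by
    linear_combination (p + q) * (α * s + β * (1 - t)) * hfirst + p * hsecond
  exact ⟨α, β, hα.le, hβ.le, hαβ, hle.trans_eq hprod.symm,
    fun h => ⟨(heq (h.trans hprod)).1, (heq (h.trans hprod)).2, hα⟩⟩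

theorem exists_weights_log_add_log_le (hp : 0 < p) (hq : 0 < q) (hs : 0 < s) (hs' : s ≤ 1)
    (ht : 0 < t) (ht' : t ≤ 1) :
    ∃ α β : ℝ, 0 ≤ α ∧ 0 ≤ β ∧ α + β = 1 ∧ 0 < α * (1 - s) + β * t ∧ 0 < α * s + β * (1 - t) ∧
      α * (2 * Real.log p + Real.log s) + β * (2 * Real.log q + Real.log t)
        ≤ 2 * Real.log (p + q)
          + (Real.log (α * (1 - s) + β * t) + Real.log (α * s + β * (1 - t))) ∧
      (α * (2 * Real.log p + Real.log s) + β * (2 * Real.log q + Real.log t)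
        = 2 * Real.log (p + q)
          + (Real.log (α * (1 - s) + β * t) + Real.log (α * s + β * (1 - t))) →
        s = 1 ∧ t = 1 ∧ 0 < α) := by
  obtain ⟨α, β, hα, hβ, hαβ, hle, heq⟩ := exists_weights_mul_add_mul_le hp hq hs hs' ht ht'
  refine ⟨α, β, hα, hβ, hαβ, ?_⟩
  have hfirst : 0 ≤ α * (1 - s) + β * t :=
    add_nonneg (mul_nonneg hα (sub_nonneg.2 hs')) (mul_nonneg hβ ht.le)
  set x := α * (1 - s) + β * t
  set y := α * s + β * (1 - t)
  have hlog {r u : ℝ} (hr : 0 < r) (hu : 0 < u) :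
      2 * Real.log r + Real.log u = Real.log (u * r ^ 2) := by
    rw [Real.log_mul hu.ne' (by positivity), Real.log_pow]
    push_cast
    ring
  have hmean : 0 < α * (s * p ^ 2) + β * (t * q ^ 2) :=
    convex_Ioi (0 : ℝ) (Set.mem_Ioi.2 (by positivity)) (Set.mem_Ioi.2 (by positivity)) hα hβ hαβ
  have hxy : 0 < x * y := pos_of_mul_pos_right (hmean.trans_le hle) (sq_nonneg _)
  have hx : 0 < x := hfirst.lt_of_ne (left_ne_zero_of_mul hxy.ne').symm
  have hy : 0 < y := pos_of_mul_pos_right hxy hx.le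
  rw [hlog hp hs, hlog hq ht, ← Real.log_mul hx.ne' hy.ne', hlog (add_pos hp hq) hxy,
    mul_comm (x * y)]
  have hjensen : α * Real.log (s * p ^ 2) + β * Real.log (t * q ^ 2)
      ≤ Real.log (α * (s * p ^ 2) + β * (t * q ^ 2)) :=
    strictConcaveOn_log_Ioi.concaveOn.2 (Set.mem_Ioi.2 (by positivity))
      (Set.mem_Ioi.2 (by positivity)) hα hβ hαβ
  have hmono := Real.log_le_log hmean hle
  exact ⟨hx, hy, hjensen.trans hmono, fun h =>
    heq (hle.antisymm ((Real.log_le_log_iff (hmean.trans_le hle) hmean).1 (h ▸ hjensen)))⟩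

end BalancingWeights

section LogAveraging

variable {ι : Type*}

theorem concaveOn_sum_log (R : Finset ι) :
    ConcaveOn ℝ {x : ι → ℝ | ∀ i ∈ R, 0 < x i} fun x => ∑ i ∈ R, Real.log (x i) := by
  refine ⟨fun x hx z hz α β hα hβ hαβ i hi =>
    convex_Ioi (0 : ℝ) (hx i hi) (hz i hi) hα hβ hαβ, fun x hx z hz α β hα hβ hαβ => ?_⟩
  simp only [Finset.smul_sum, ← Finset.sum_add_distrib]
  exact Finset.sum_le_sum fun i hi =>
    strictConcaveOn_log_Ioi.concaveOn.2 (hx i hi) (hz i hi) hα hβ hαβ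

theorem exists_mem_segment_sum_log [DecidableEq ι] {S : Finset ι} {a b : ι} (ha : a ∈ S)
    (hb : b ∈ S) (hab : a ≠ b) {p q : ℝ} (hp : 0 < p) (hq : 0 < q) {z w : ι → ℝ}
    (hz : ∀ v ∈ S.erase a, 0 < z v) (hw : ∀ v ∈ S.erase b, 0 < w v)
    (hzab : z a + z b = 1) (hwab : w a + w b = 1) (hzb : z b ≤ 1) (hwa : w a ≤ 1)
    (hzlog : 0 ≤ 2 * Real.log p + ∑ v ∈ S.erase a, Real.log (z v))
    (hwlog : 0 ≤ 2 * Real.log q + ∑ v ∈ S.erase b, Real.log (w v)) :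
    ∃ y ∈ segment ℝ z w, (∀ v ∈ S, 0 < y v) ∧
      0 ≤ 2 * Real.log (p + q) + ∑ v ∈ S, Real.log (y v) ∧
      (2 * Real.log (p + q) + ∑ v ∈ S, Real.log (y v) = 0 → z b = 1 ∧ w a = 1 ∧
        2 * Real.log p + ∑ v ∈ S.erase a, Real.log (z v) = 0) := by
  have hbS : b ∈ S.erase a := Finset.mem_erase.2 ⟨hab.symm, hb⟩
  have haS : a ∈ S.erase b := Finset.mem_erase.2 ⟨hab, ha⟩
  obtain ⟨α, β, hα, hβ, hαβ, hxpos, hypos, hle, heq⟩ :=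
    exists_weights_log_add_log_le hp hq (hz b hbS) hzb (hw a haS) hwa
  set y := α • z + β • w
  have hya : y a = α * (1 - z b) + β * w a := by simp [y, ← hzab]
  have hyb : y b = α * z b + β * (1 - w a) := by simp [y, ← hwab]
  rw [← hya] at hxpos hle heq
  rw [← hyb] at hypos hle heq
  set R := (S.erase a).erase b
  have hR : (S.erase b).erase a = R := Finset.erase_right_comm
  have hzR : ∀ v ∈ R, 0 < z v := fun v hv => hz v (Finset.mem_of_mem_erase hv)
  have hwR : ∀ v ∈ R, 0 < w v := fun v hv => hw v (Finset.mem_of_mem_erase (hR ▸ hv))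
  have hyR : ∀ v ∈ R, 0 < y v := (concaveOn_sum_log R).1 hzR hwR hα hβ hαβ
  have hRlog : α * ∑ v ∈ R, Real.log (z v) + β * ∑ v ∈ R, Real.log (w v)
      ≤ ∑ v ∈ R, Real.log (y v) := (concaveOn_sum_log R).2 hzR hwR hα hβ hαβ
  rw [← Finset.add_sum_erase _ _ hbS] at hzlog ⊢
  rw [← Finset.add_sum_erase _ _ haS, hR] at hwlog
  simp only [← Finset.add_sum_erase _ _ ha, ← Finset.add_sum_erase _ _ hbS]
  have hzlog' := mul_nonneg hα hzlog
  have hwlog' := mul_nonneg hβ hwlog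
  refine ⟨y, ⟨α, β, hα, hβ, hαβ, rfl⟩, fun v hv => ?_, by linarith, fun h => ?_⟩
  · by_cases hva : v = a
    · rwa [hva]
    by_cases hvb : v = b
    · rwa [hvb]
    exact hyR v (by simp [R, hva, hvb, hv])
  · obtain ⟨hzb1, hwa1, hα0⟩ := heq (by linarith)
    exact ⟨hzb1, hwa1, (mul_eq_zero.1 (by linarith)).resolve_left hα0.ne'⟩

end LogAveraging

section EntropyWitness

variable {P : Type*} [PartialOrder P]

/-- The vector `x` is positive on `S` and satisfies `-∑ v ∈ S, log (x v) ≤ 2 log e(S)`, where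
equality holds only if the incomparability graph restricted to `S` is a matching. Applied to `S = P`
and a point `x` of the stable set polytope, this bounds the entropy from above. -/
structure IsEntropyWitness (S : Finset P) (x : P → ℝ) : Prop where
  pos : ∀ v ∈ S, 0 < x v
  nonneg : 0 ≤ 2 * Real.log (linExtLists S).ncard + ∑ v ∈ S, Real.log (x v)
  isMatchingOn_of_eq : 2 * Real.log (linExtLists S).ncard + ∑ v ∈ S, Real.log (x v) = 0 →
    IsMatchingOn (incompGraph P) (S : Set P)

theorem isEntropyWitness_empty (x : P → ℝ) : IsEntropyWitness (∅ : Finset P) x where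
  pos := by simp
  nonneg := by simp [linExtLists_empty]
  isMatchingOn_of_eq := by simp [IsMatchingOn]

theorem IsEntropyWitness.mono {S : Finset P} {x z : P → ℝ} (hx : IsEntropyWitness S x)
    (hxz : x ≤ z) : IsEntropyWitness S z := by
  have hlog : ∑ v ∈ S, Real.log (x v) ≤ ∑ v ∈ S, Real.log (z v) :=
    Finset.sum_le_sum fun v hv => Real.log_le_log (hx.pos v hv) (hxz v)
  have hnonneg := hx.nonneg
  exact ⟨fun v hv => (hx.pos v hv).trans_le (hxz v), by linarith,
    fun h => hx.isMatchingOn_of_eq (by linarith)⟩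

variable {S : Finset P} {a b : P}

theorem IsEntropyWitness.update_of_isLeast [DecidableEq P] {x : P → ℝ}
    (hx : IsEntropyWitness (S.erase a) x) (ha : IsLeast (S : Set P) a) :
    IsEntropyWitness S (Function.update x a 1) := by
  have haS : a ∈ S := ha.1
  have hcount : (0 : ℝ) < (linExtLists (S.erase a)).ncard :=
    Nat.cast_pos.2 (ncard_linExtLists_pos _)
  have hmono : Real.log (linExtLists (S.erase a)).ncard ≤ Real.log (linExtLists S).ncard :=
    Real.log_le_log hcount (Nat.cast_le.2 (ncard_linExtLists_erase_le ha.minimal))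
  have hsum : ∑ v ∈ S, Real.log (Function.update x a 1 v) = ∑ v ∈ S.erase a, Real.log (x v) := by
    rw [← Finset.add_sum_erase _ _ haS, Function.update_self, Real.log_one, zero_add]
    exact Finset.sum_congr rfl fun v hv => by rw [Function.update_of_ne (Finset.ne_of_mem_erase hv)]
  have hnonneg := hx.nonneg
  refine ⟨fun v hv => ?_, by linarith, fun h => ?_⟩
  · by_cases hva : v = a
    · simp [hva]
    · simpa [hva] using hx.pos v (Finset.mem_erase.2 ⟨hva, hv⟩)
  · have hmatch := hx.isMatchingOn_of_eq (by linarith)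
    rw [Finset.coe_erase] at hmatch
    exact hmatch.of_diff_singleton (fun c hc hca => absurd (ha.2 hc) hca.2)
      fun c hc hca => absurd (ha.2 hc) hca.2

theorem exists_mem_segment_isEntropyWitness [DecidableEq P] (ha : Minimal (· ∈ S) a)
    (hb : Minimal (· ∈ S) b) (hab : a ≠ b) {z w : P → ℝ} (hzmem : z ∈ chainHull (S : Set P))
    (hwmem : w ∈ chainHull (S : Set P)) (hzab : z a + z b = 1) (hwab : w a + w b = 1)
    (hz : IsEntropyWitness (S.erase a) z) (hw : IsEntropyWitness (S.erase b) w) :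
    ∃ u ∈ segment ℝ z w, IsEntropyWitness S u := by
  have hzstab := chainHull_subset_stabPolytope _ hzmem
  have hwstab := chainHull_subset_stabPolytope _ hwmem
  have hp : (0 : ℝ) < (linExtLists (S.erase a)).ncard := Nat.cast_pos.2 (ncard_linExtLists_pos _)
  have hq : (0 : ℝ) < (linExtLists (S.erase b)).ncard := Nat.cast_pos.2 (ncard_linExtLists_pos _)
  obtain ⟨u, hu, hupos, hulog, hueq⟩ := exists_mem_segment_sum_log ha.1 hb.1 hab hp hq hz.pos hw.pos
    hzab hwab (le_one_of_mem_stabPolytope hzstab b) (le_one_of_mem_stabPolytope hwstab a)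
    hz.nonneg hw.nonneg
  have hcount : Real.log ((linExtLists (S.erase a)).ncard + (linExtLists (S.erase b)).ncard : ℝ)
      ≤ Real.log (linExtLists S).ncard :=
    Real.log_le_log (add_pos hp hq) (by exact_mod_cast ncard_linExtLists_erase_add_le ha hb hab)
  refine ⟨u, hu, hupos, by linarith, fun h => ?_⟩
  obtain ⟨hzb, hwa, hzero⟩ := hueq (by linarith)
  have hmatch := hz.isMatchingOn_of_eq hzero
  rw [Finset.coe_erase] at hmatch
  refine hmatch.of_diff_singleton (b := b) (fun c hc hca => ?_) fun c hc hcb => ?_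
  · by_contra hcb
    linarith [add_le_one_of_mem_stabPolytope hwstab hca, hw.pos c (by simp_all)]
  · by_contra hca
    linarith [add_le_one_of_mem_stabPolytope hzstab hcb, hz.pos c (by simp_all)]

theorem exists_isEntropyWitness (hG : (incompGraph P).CliqueFree 3) (S : Finset P) :
    ∃ x ∈ chainHull (S : Set P), IsEntropyWitness S x := by
  classical
  induction S using Finset.strongInduction with
  | H S ih =>
    have hrec {c : P} (hc : c ∈ S) :
        ∃ x ∈ chainHull ((S : Set P) \ {c}), IsEntropyWitness (S.erase c) x := by
      simpa using ih _ (Finset.erase_ssubset hc)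
    rcases S.eq_empty_or_nonempty with rfl | hS
    · exact ⟨_, indicator_mem_chainHull (Set.empty_subset _) .empty, isEntropyWitness_empty _⟩
    rcases exists_isLeast_or_exists_minimal_pair hS with ⟨a, ha⟩ | ⟨a, b, hab, ha, hb⟩
    · obtain ⟨x, hxmem, hx⟩ := hrec ha.1
      exact ⟨_, update_one_mem_chainHull ha.1 (fun c hc => Or.inl (ha.2 hc)) hxmem,
        hx.update_of_isLeast ha⟩
    · obtain ⟨x, hxmem, hx⟩ := hrec ha.1
      obtain ⟨y, hymem, hy⟩ := hrec hb.1
      obtain ⟨z, hzmem, hxz, hzab⟩ := exists_mem_chainHull_add_eq_one hG ha hb hab hxmem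
      obtain ⟨w, hwmem, hyw, hwba⟩ := exists_mem_chainHull_add_eq_one hG hb ha hab.symm hymem
      obtain ⟨u, hu, huS⟩ := exists_mem_segment_isEntropyWitness ha hb hab hzmem hwmem hzab
        ((add_comm _ _).trans hwba) (hx.mono hxz) (hy.mono hyw)
      exact ⟨u, (convex_convexHull ℝ _).segment_subset hzmem hwmem hu, huS⟩

theorem exists_mem_stabPolytope_neg_sum_logb_le [Fintype P] [DecidableRel (incompGraph P).Adj]
    (hG : (incompGraph P).CliqueFree 3) :
    ∃ x ∈ stabPolytope (incompGraph P), (∀ v, 0 < x v) ∧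
      -∑ v, Real.logb 2 (x v) ≤ 2 * Real.logb 2 (numLinearExtensions P) ∧
      (-∑ v, Real.logb 2 (x v) = 2 * Real.logb 2 (numLinearExtensions P) →
        (incompGraph P).maxDegree ≤ 1) := by
  obtain ⟨x, hxmem, hx⟩ := exists_isEntropyWitness hG Finset.univ
  have hlog2 : 0 < Real.log 2 := Real.log_pos one_lt_two
  have hcount : Real.log (linExtLists (Finset.univ : Finset P)).ncard
      ≤ Real.log (numLinearExtensions P) :=
    Real.log_le_log (Nat.cast_pos.2 (ncard_linExtLists_pos _))
      (Nat.cast_le.2 (ncard_linExtLists_univ_le P))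
  have hnonneg := hx.nonneg
  have hx_scale : -∑ v, Real.logb 2 (x v) = (-∑ v, Real.log (x v)) / Real.log 2 := by
    simp only [Real.logb, ← Finset.sum_div, neg_div]
  have he_scale : 2 * Real.logb 2 (numLinearExtensions P)
      = 2 * Real.log (numLinearExtensions P) / Real.log 2 := by
    rw [Real.logb, mul_div_assoc]
  refine ⟨x, chainHull_subset_stabPolytope _ hxmem, fun v => hx.pos v (Finset.mem_univ v), ?_⟩
  rw [hx_scale, he_scale, div_left_inj' hlog2.ne', div_le_div_iff_of_pos_right hlog2]
  refine ⟨by linarith, fun h => isMatchingOn_univ_iff_maxDegree_le_one.1 ?_⟩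
  simpa using hx.isMatchingOn_of_eq (by linarith)

theorem card_mul_graphEntropy_le_two_mul_logb [Fintype P]
    (hG : (incompGraph P).CliqueFree 3) :
    Fintype.card P * graphEntropy (incompGraph P) ≤ 2 * Real.logb 2 (numLinearExtensions P) := by
  classical
  obtain ⟨x, hx, hpos, hle, -⟩ := exists_mem_stabPolytope_neg_sum_logb_le hG
  exact ((isLeast_card_mul_graphEntropy (incompGraph P)).2 ⟨x, ⟨hx, hpos⟩, rfl⟩).trans hle

theorem maxDegree_le_one_of_card_mul_graphEntropy_eq [Fintype P]
    [DecidableRel (incompGraph P).Adj] (hG : (incompGraph P).CliqueFree 3)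
    (h : Fintype.card P * graphEntropy (incompGraph P)
      = 2 * Real.logb 2 (numLinearExtensions P)) : (incompGraph P).maxDegree ≤ 1 := by
  obtain ⟨x, hx, hpos, hle, heq⟩ := exists_mem_stabPolytope_neg_sum_logb_le hG
  have hmin := (isLeast_card_mul_graphEntropy (incompGraph P)).2 ⟨x, ⟨hx, hpos⟩, rfl⟩
  exact heq (hle.antisymm (h.symm.trans_le hmin))

end EntropyWitness

section CountingLinearExtensions

variable {n : ℕ}

theorem equiv_fin_eq_of_lt_imp_lt {α : Type*} {f g : α ≃ Fin n}
    (h : ∀ u v, f u < f v → g u < g v) : f = g := by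
  have hmono : StrictMono (f.symm.trans g) := fun i j hij => h _ _ (by simpa using hij)
  have hrefl : hmono.orderIsoOfSurjective _ (f.symm.trans g).surjective = OrderIso.refl _ :=
    Subsingleton.elim _ _
  ext1 u
  simpa using (DFunLike.congr_fun hrefl (f u)).symm

variable {P : Type*} [PartialOrder P] {f g : P ≃ Fin n}

theorem eq_of_monotone_of_forall_incompGraph_adj (hf : Monotone f) (hg : Monotone g)
    (h : ∀ u v, (incompGraph P).Adj u v → f u < f v → g u < g v) : f = g := by
  refine equiv_fin_eq_of_lt_imp_lt fun u v huv => ?_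
  by_cases hle : u ≤ v
  · exact (hg hle).lt_of_ne (g.injective.ne (ne_of_apply_ne f huv.ne))
  · exact h u v ⟨hle, fun hvu => (hf hvu).not_gt huv⟩ huv

theorem numLinearExtensions_le_two_pow (P : Type*) [PartialOrder P] [Fintype P]
    [DecidableRel (incompGraph P).Adj] :
    numLinearExtensions P ≤ 2 ^ (incompGraph P).edgeFinset.card := by
  rw [SimpleGraph.edgeFinset_card, ← Fintype.card_finset, ← Nat.card_eq_fintype_card]
  -- `Quot.out` orders the two ends of each edge arbitrarily; a linear extension is determined by
  -- the set of edges on which it agrees with that order.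
  refine Nat.card_le_card_of_injective (fun f : {f : P ≃ Fin (Fintype.card P) // Monotone f} =>
    Finset.univ.filter fun e : (incompGraph P).edgeSet => f.1 e.1.out.1 < f.1 e.1.out.2) ?_
  rintro ⟨f, hf⟩ ⟨g, hg⟩ hfg
  refine Subtype.ext (eq_of_monotone_of_forall_incompGraph_adj hf hg fun u v huv hlt => ?_)
  have horient : f s(u, v).out.1 < f s(u, v).out.2 ↔ g s(u, v).out.1 < g s(u, v).out.2 := by
    simpa using Finset.ext_iff.1 hfg ⟨s(u, v), huv⟩
  have hout : s(s(u, v).out.1, s(u, v).out.2) = s(u, v) := Quot.out_eq _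
  rcases Sym2.eq_iff.1 hout with ⟨hu, hv⟩ | ⟨hu, hv⟩
  · rw [hu, hv] at horient
    exact horient.1 hlt
  · rw [hu, hv] at horient
    exact (not_lt.1 (horient.not.1 hlt.not_gt)).lt_of_ne (g.injective.ne huv.ne)

end CountingLinearExtensions

section OrdinalSum

variable {P : Type*} [PartialOrder P]

theorem IsOrdinalSumOfSmallAntichains.eq_of_incompGraph_adj (h : IsOrdinalSumOfSmallAntichains P)
    {u v w : P} (huv : (incompGraph P).Adj u v) (huw : (incompGraph P).Adj u w) : v = w := by
  obtain ⟨k, A, -, hcard, hpart, hlt⟩ := h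
  obtain ⟨i, hi, -⟩ := hpart u
  have hmem {c : P} (hc : (incompGraph P).Adj u c) : c ∈ A i := by
    obtain ⟨j, hj, -⟩ := hpart c
    rcases lt_trichotomy i j with hij | rfl | hij
    · exact absurd (hlt i j hij u hi c hj).le hc.1
    · exact hj
    · exact absurd (hlt j i hij c hj u hi).le hc.2
  by_contra hvw
  have hthree : 2 < (A i).card :=
    Finset.two_lt_card.2 ⟨u, hi, v, hmem huv, w, hmem huw, huv.ne, huw.ne, hvw⟩
  have := hcard i
  omega

theorem isOrdinalSumOfSmallAntichains_of_lt_iff_lt [Fintype P] {α : Type*} [LinearOrder α]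
    (r : P → α) (hr : ∀ x y, x < y ↔ r x < r y)
    (hcard : ∀ i, (Finset.univ.filter fun x => r x = i).card ≤ 2) :
    IsOrdinalSumOfSmallAntichains P := by
  set values := Finset.univ.image r
  set level := values.orderEmbOfFin rfl
  refine ⟨values.card, fun i => Finset.univ.filter fun x => r x = level i,
    fun i x hx y hy hxy hle => ?_, fun i => ?_, fun x => ?_, fun i j hij x hx y hy => ?_⟩
  · have hlt := (hr x y).1 (hle.lt_of_ne hxy)
    simp_all
  · obtain ⟨x, -, hx⟩ := Finset.mem_image.1 (values.orderEmbOfFin_mem rfl i)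
    have hpos : 0 < (Finset.univ.filter fun x => r x = level i).card :=
      Finset.card_pos.2 ⟨x, by simpa using hx⟩
    have := hcard (level i)
    beta_reduce
    omega
  · obtain ⟨i, hi⟩ : r x ∈ Set.range level := by
      simp [level, values]
    refine ⟨i, by simp [hi], fun j hj => level.injective ?_⟩
    exact (Finset.mem_filter.1 hj).2.symm.trans hi.symm
  · simp only [Finset.mem_filter, Finset.mem_univ, true_and] at hx hy
    rw [hr, hx, hy]
    exact level.strictMono hij

theorem Iio_subset_Iio_of_incompGraph_adj
    (h : ∀ u v w : P, (incompGraph P).Adj u v → (incompGraph P).Adj u w → v = w) {x y : P}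
    (hxy : (incompGraph P).Adj x y) : Set.Iio x ⊆ Set.Iio y := by
  intro z hz
  have hyz : ¬ y ≤ z := fun hyz => hxy.2 (hyz.trans hz.le)
  by_contra hzy
  have hzy' : (incompGraph P).Adj y z := ⟨hyz, fun hle => hzy (hle.lt_of_not_ge hyz)⟩
  exact hz.ne' (h y x z hxy.symm hzy')

theorem isOrdinalSumOfSmallAntichains_of_adj_unique [Finite P]
    (h : ∀ u v w : P, (incompGraph P).Adj u v → (incompGraph P).Adj u w → v = w) :
    IsOrdinalSumOfSmallAntichains P := by
  classical
  have := Fintype.ofFinite P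
  have hlt {x y : P} (hxy : x < y) : (Set.Iio x).ncard < (Set.Iio y).ncard :=
    Set.ncard_lt_ncard (Set.Iio_ssubset_Iio hxy) (Set.toFinite _)
  have heq {x y : P} (hxy : (incompGraph P).Adj x y) : (Set.Iio x).ncard = (Set.Iio y).ncard := by
    rw [(Iio_subset_Iio_of_incompGraph_adj h hxy).antisymm
      (Iio_subset_Iio_of_incompGraph_adj h hxy.symm)]
  have hadj {x y : P} (hne : x ≠ y) (hxy : (Set.Iio x).ncard = (Set.Iio y).ncard) :
      (incompGraph P).Adj x y :=
    ⟨fun hle => (hlt (hle.lt_of_ne hne)).ne hxy, fun hle => (hlt (hle.lt_of_ne' hne)).ne' hxy⟩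
  refine isOrdinalSumOfSmallAntichains_of_lt_iff_lt (fun x => (Set.Iio x).ncard)
    (fun x y => ⟨hlt, fun hxy => ?_⟩) fun i => ?_
  · rcases lt_or_eq_or_gt_or_incompRel x y with hlt' | rfl | hgt | hinc
    · exact hlt'
    · exact absurd hxy (lt_irrefl _)
    · exact absurd hxy (hlt hgt).asymm
    · exact absurd (heq hinc) hxy.ne
  · by_contra! hthree
    obtain ⟨a, ha, b, hb, c, hc, hab, hac, hbc⟩ := Finset.two_lt_card.1 hthree
    simp only [Finset.mem_filter, Finset.mem_univ, true_and] at ha hb hc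
    exact hbc (h a b c (hadj hab (ha.trans hb.symm)) (hadj hac (ha.trans hc.symm)))

theorem isOrdinalSumOfSmallAntichains_iff_maxDegree_le_one [Fintype P]
    [DecidableRel (incompGraph P).Adj] :
    IsOrdinalSumOfSmallAntichains P ↔ (incompGraph P).maxDegree ≤ 1 := by
  rw [maxDegree_le_one_iff]
  exact ⟨fun h _ _ _ => h.eq_of_incompGraph_adj, isOrdinalSumOfSmallAntichains_of_adj_unique⟩

end OrdinalSum

theorem card_mul_graphEntropy_eq_iff_maxDegree_le_one {P : Type*} [PartialOrder P] [Fintype P]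
    [DecidableRel (incompGraph P).Adj] (hG : (incompGraph P).CliqueFree 3) :
    Fintype.card P * graphEntropy (incompGraph P) = 2 * Real.logb 2 (numLinearExtensions P) ↔
      (incompGraph P).maxDegree ≤ 1 := by
  refine ⟨maxDegree_le_one_of_card_mul_graphEntropy_eq hG, fun hdeg =>
    (card_mul_graphEntropy_le_two_mul_logb hG).antisymm ?_⟩
  have hcount : Real.logb 2 (numLinearExtensions P) ≤ (incompGraph P).edgeFinset.card := by
    rw [Real.logb_le_iff_le_rpow one_lt_two (Nat.cast_pos.2 (numLinearExtensions_pos P)),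
      Real.rpow_natCast]
    exact_mod_cast numLinearExtensions_le_two_pow P
  calc 2 * Real.logb 2 (numLinearExtensions P)
      ≤ 2 * (incompGraph P).edgeFinset.card := by gcongr
    _ ≤ (incompGraph P).maxDegree * (Fintype.card P * graphEntropy (incompGraph P)) :=
        two_mul_card_edgeFinset_le_maxDegree_mul_graphEntropy _
    _ ≤ Fintype.card P * graphEntropy (incompGraph P) :=
        mul_le_of_le_one_left (card_mul_graphEntropy_nonneg _) (by exact_mod_cast hdeg)

theorem mainTheorem2 (P : Type*) [PartialOrder P] [Fintype P]
    [DecidableRel (incompGraph P).Adj] (hP : posetWidth P = 2) :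
    ((Fintype.card P : ℝ) * graphEntropy (incompGraph P)
        = 2 * Real.logb 2 (numLinearExtensions P : ℝ) ↔
      (incompGraph P).maxDegree = 1) ∧
    ((incompGraph P).maxDegree = 1 ↔ IsOrdinalSumOfSmallAntichains P) := by
  have htriangleFree : (incompGraph P).CliqueFree 3 := by
    simp [cliqueFree_incompGraph_iff_posetWidth_lt, hP]
  have hedge : (incompGraph P).maxDegree ≠ 0 := by
    rw [Ne, SimpleGraph.maxDegree_eq_zero_iff, ← SimpleGraph.cliqueFree_two,
      cliqueFree_incompGraph_iff_posetWidth_lt, hP]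
    exact lt_irrefl 2
  have hdeg : (incompGraph P).maxDegree = 1 ↔ (incompGraph P).maxDegree ≤ 1 := by lia
  rw [hdeg, isOrdinalSumOfSmallAntichains_iff_maxDegree_le_one]
  exact ⟨card_mul_graphEntropy_eq_iff_maxDegree_le_one htriangleFree, Iff.rfl⟩
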